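/- Let $\mathbb F_q$ be the finite field with $q$ elements, listed as $\mathbb F_q=\{a_0=0,a_1=1,a_2,\dots,a_{q-1}\}$ in any fixed way. For $f=a_{i_0}+a_{i_1}t+\cdots+a_{i_n}t^n\in\mathbb F_q[t]$ put $\delta(f)=i_0+i_1q+\cdots+i_nq^n$, and order $\mathbb F_q[t]$ by $g<f$ if and only if $\delta(g)<\delta(f)$. Define the factorial of $f$ by $f!=\prod_{g<f}(f-g)$ for $f\neq0$ and $0!=1$. For $f\ne 0$ let $S(f)$ be the smallest $g\in\mathbb F_q[t]$, with respect to this order, such that $f\mid g!$, and put $S(0)=0$. For a non-constant $f$ let $\mathcal P(f)$ be the largest monic irreducible factor of $f$ with respect to this order. For an integer $n\ge1$ let $$\mathcal T(n)=\{f\in\mathbb F_q[t]\text{ monic}:\ \deg f=n,\ S(f)\ne t^{\deg\mathcal P(f)}\}.$$ Theorem. If $q=2$ and $n\ge3249$, then $|\mathcal T(n)|<2^{n+2}\exp(-\sqrt n/3)$. If $q\ge3$ and $n\ge\max\{13000,\log q\}$, then $|\mathcal T(n)|<4q^n\exp(-\sqrt n/2)$. Consequently, for almost all $f\in\mathbb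 F_q[t]$ one has $S(f)=t^d$, where $d$ is the largest degree of an irreducible factor of $f$; that is, for fixed $q$, the proportion of such $f$ among all polynomials of degree $n$ tends to $1$ as $n\to\infty$. -/

import Mathlib

open Polynomial

noncomputable section

namespace CarlitzSmarandache

/-- An enumeration `F = {a₀ = 0, a₁ = 1, a₂, …, a_{q-1}}` of a finite field with `q` elements. -/
structure Enumeration (F : Type*) [Field F] [Fintype F] where
  /-- the indexed listing `i ↦ a_i` -/
  elem : Fin (Fintype.card F) ≃ F
  elem_symm_zero : (elem.symm 0 : ℕ) = 0
  elem_symm_one : (elem.symm 1 : ℕ) = 1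

variable {F : Type*} [Field F] [Fintype F] (a : Enumeration F)

/-- The index of a field element: `a.digit c = i` means `c = a_i`. -/
def Enumeration.digit (c : F) : ℕ := (a.elem.symm c : ℕ)

/-- `δ(f) = i₀ + i₁ q + ⋯ + i_n q ^ n` for `f = a_{i₀} + a_{i₁} t + ⋯ + a_{i_n} t ^ n`; `δ(0) = 0`. -/
def delta (f : F[X]) : ℕ :=
  ∑ i ∈ Finset.range (f.natDegree + 1), a.digit (f.coeff i) * Fintype.card F ^ i

theorem digit_lt (c : F) : a.digit c < Fintype.card F := (a.elem.symm c).2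

theorem digit_zero : a.digit 0 = 0 := a.elem_symm_zero

theorem digit_one : a.digit 1 = 1 := a.elem_symm_one

theorem digit_injective {c d : F} (h : a.digit c = a.digit d) : c = d :=
  a.elem.symm.injective (Fin.ext h)

theorem digit_pos {c : F} (hc : c ≠ 0) : 1 ≤ a.digit c := by
  rcases Nat.eq_zero_or_pos (a.digit c) with h | h
  · exact absurd (digit_injective a (h.trans (digit_zero a).symm)) hc
  · exact h

theorem delta_eq_sum {f : F[X]} {N : ℕ} (h : f.natDegree < N) :
    delta a f = ∑ i ∈ Finset.range N, a.digit (f.coeff i) * Fintype.card F ^ i := by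
  refine Finset.sum_subset (Finset.range_subset_range.2 h) fun i _ hi => ?_
  rw [coeff_eq_zero_of_natDegree_lt (by simpa using hi), digit_zero, zero_mul]

theorem delta_zero : delta a (0 : F[X]) = 0 := by
  simp [delta, digit_zero]

theorem sum_digit_lt (c : ℕ → F) (N : ℕ) :
    ∑ i ∈ Finset.range N, a.digit (c i) * Fintype.card F ^ i < Fintype.card F ^ N := by
  induction N with
  | zero => simp
  | succ k ih =>
    rw [Finset.sum_range_succ, pow_succ]
    have h1 := digit_lt a (c k)
    have h2 : (a.digit (c k) + 1) * Fintype.card F ^ k ≤ Fintype.card F * Fintype.card F ^ k :=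
      Nat.mul_le_mul_right _ h1
    nlinarith

theorem sum_digit_injective (c d : ℕ → F) (N : ℕ)
    (h : ∑ i ∈ Finset.range N, a.digit (c i) * Fintype.card F ^ i =
      ∑ i ∈ Finset.range N, a.digit (d i) * Fintype.card F ^ i) :
    ∀ i < N, c i = d i := by
  induction N with
  | zero => simp
  | succ k ih =>
    rw [Finset.sum_range_succ, Finset.sum_range_succ] at h
    have hc := sum_digit_lt a c k
    have hd := sum_digit_lt a d k
    have hk : a.digit (c k) = a.digit (d k) := by
      have hq : 0 < Fintype.card F ^ k := by omega
      have h3 := congrArg (· / Fintype.card F ^ k) h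
      simpa [Nat.add_mul_div_right _ _ hq, Nat.div_eq_of_lt hc, Nat.div_eq_of_lt hd] using h3
    rw [hk] at h
    intro i hi
    rcases Nat.lt_succ_iff_lt_or_eq.1 hi with h' | rfl
    · exact ih (by omega) i h'
    · exact digit_injective a hk

/-- `δ` is injective, so comparing values of `δ` is a linear order on polynomials. -/
theorem delta_injective : Function.Injective (delta a) := by
  intro f g h
  rw [delta_eq_sum a (show f.natDegree < max f.natDegree g.natDegree + 1 by omega),
    delta_eq_sum a (show g.natDegree < max f.natDegree g.natDegree + 1 by omega)] at h
  ext i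
  by_cases hi : i < max f.natDegree g.natDegree + 1
  · exact sum_digit_injective a f.coeff g.coeff _ h i hi
  · rw [coeff_eq_zero_of_natDegree_lt (by omega), coeff_eq_zero_of_natDegree_lt (by omega)]

theorem pow_le_delta {f : F[X]} (hf : f ≠ 0) : Fintype.card F ^ f.natDegree ≤ delta a f := by
  rw [delta, Finset.sum_range_succ]
  have h := digit_pos a (c := f.coeff f.natDegree) (by simpa using hf)
  exact (Nat.le_mul_of_pos_left _ h).trans (Nat.le_add_left _ _)

theorem delta_lt_pow {f : F[X]} {n : ℕ} (h : f.degree < n) : delta a f < Fintype.card F ^ n := by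
  rcases eq_or_ne f 0 with rfl | hf
  · rw [delta_zero]
    exact pow_pos Fintype.card_pos _
  · rw [delta_eq_sum a ((natDegree_lt_iff_degree_lt hf).2 h)]
    exact sum_digit_lt a _ _

theorem finite_degree_lt (n : ℕ) : {f : F[X] | f.degree < n}.Finite := by
  have : Finite (degreeLT F n) := Finite.of_equiv _ (degreeLTEquiv F n).toEquiv.symm
  refine (Set.toFinite (degreeLT F n : Set F[X])).subset fun f hf => ?_
  exact mem_degreeLT.2 hf

theorem finite_delta_lt (m : ℕ) : {g : F[X] | delta a g < m}.Finite :=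
  Set.Finite.preimage (delta_injective a).injOn (Set.finite_Iio m)

/-- The factorial `f! = ∏_{g < f} (f - g)`, where `g < f` means `δ(g) < δ(f)`; in particular
`0! = 1`. -/
def polyFactorial (f : F[X]) : F[X] :=
  ∏ g ∈ (finite_delta_lt a (delta a f)).toFinset, (f - g)

theorem polyFactorial_zero : polyFactorial a (0 : F[X]) = 1 := by
  refine Finset.prod_eq_one fun g hg => ?_
  simp [delta_zero] at hg

theorem exists_dvd_polyFactorial {f : F[X]} (hf : f ≠ 0) :
    {g : F[X] | f ∣ polyFactorial a g}.Nonempty := by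
  refine ⟨C f.leadingCoeff * X ^ f.natDegree, ?_⟩
  have hlt : delta a (C f.leadingCoeff * X ^ f.natDegree - f) <
      delta a (C f.leadingCoeff * X ^ f.natDegree) := by
    have hl : f.leadingCoeff ≠ 0 := leadingCoeff_ne_zero.2 hf
    have h0 : C f.leadingCoeff * X ^ f.natDegree ≠ 0 := by simp [hf]
    have h1 := pow_le_delta a h0
    rw [natDegree_C_mul_X_pow _ _ hl] at h1
    refine (delta_lt_pow a (n := f.natDegree) ?_).trans_le h1
    have h2 : (C f.leadingCoeff * X ^ f.natDegree).degree = f.degree := by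
      rw [degree_C_mul_X_pow _ hl, degree_eq_natDegree hf]
    have h3 := degree_sub_lt_left h2 h0 (by simp)
    rwa [h2, degree_eq_natDegree hf] at h3
  have h := Finset.dvd_prod_of_mem (fun g => C f.leadingCoeff * X ^ f.natDegree - g)
    ((Set.Finite.mem_toFinset (finite_delta_lt a _)).2 hlt)
  rw [sub_sub_cancel] at h
  exact h

open Classical in
/-- The Smarandache function: for `f ≠ 0`, `S(f)` is the smallest (with respect to `δ`)
polynomial `g` such that `f ∣ g!`; and `S(0) = 0`. -/
def smarandache (f : F[X]) : F[X] :=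
  if hf : f = 0 then 0
  else Function.argminOn (delta a) {g : F[X] | f ∣ polyFactorial a g}
    (exists_dvd_polyFactorial a hf)

/-- `P` is the largest (with respect to `δ`) monic irreducible factor of `f`. -/
def IsLargestPrimeFactor (f P : F[X]) : Prop :=
  P.Monic ∧ Irreducible P ∧ P ∣ f ∧
    ∀ Q : F[X], Q.Monic → Irreducible Q → Q ∣ f → delta a Q ≤ delta a P

theorem exists_isLargestPrimeFactor {f : F[X]} (hf : 0 < f.natDegree) :
    ∃ P, IsLargestPrimeFactor a f P := by
  have hf0 : f ≠ 0 := by rintro rfl; simp at hf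
  have hfin : {P : F[X] | P.Monic ∧ Irreducible P ∧ P ∣ f}.Finite := by
    refine (finite_degree_lt (F := F) (f.natDegree + 1)).subset fun P hP => ?_
    have h := degree_le_of_dvd hP.2.2 hf0
    rw [degree_eq_natDegree hf0] at h
    exact h.trans_lt (by exact_mod_cast Nat.lt_succ_self _)
  have hne : {P : F[X] | P.Monic ∧ Irreducible P ∧ P ∣ f}.Nonempty := by
    obtain ⟨P, h1, h2, h3⟩ := exists_monic_irreducible_factor f
      (not_isUnit_of_natDegree_pos f hf)
    exact ⟨P, h1, h2, h3⟩
  obtain ⟨P, hP, hmax⟩ := Set.exists_max_image _ (delta a) hfin hne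
  exact ⟨P, hP.1, hP.2.1, hP.2.2, fun Q h1 h2 h3 => hmax Q ⟨h1, h2, h3⟩⟩

open Classical in
/-- The largest monic irreducible factor of a non-constant `f` (and `1` for constant `f`). -/
def largestPrimeFactor (f : F[X]) : F[X] :=
  if hf : 0 < f.natDegree then (exists_isLargestPrimeFactor a hf).choose else 1

/-- The set of monic `f` of degree `n` with `S(f) ≠ t ^ deg P(f)`, where `P(f)` is the largest
monic irreducible factor of `f`. -/
def exceptionalSet (n : ℕ) : Set F[X] :=
  {f | f.Monic ∧ f.natDegree = n ∧ smarandache a f ≠ X ^ (largestPrimeFactor a f).natDegree}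

theorem finite_exceptionalSet (n : ℕ) : (exceptionalSet a n).Finite := by
  refine (finite_degree_lt (F := F) (n + 1)).subset fun f hf => ?_
  have h : f.degree = n := by rw [degree_eq_natDegree hf.1.ne_zero, hf.2.1]
  change f.degree < _
  rw [h]
  exact_mod_cast Nat.lt_succ_self n

end CarlitzSmarandache

end

/-! Let `d` be the largest degree of a prime factor of `f`. The factors of `(t^d)!` are exactly the
monic polynomials of degree `d`, while every factor of `g!` with `g < t^d` has degree below `d`.
Hence `S(f) = t^d` as soon as `f ∣ (t^d)!` (`smarandache_eq_X_pow`). A prime `Q` of degree `e ≤ d`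
divides `(t^d)!` at least `q^(d-e)` times, so an exceptional `f` is divisible by `Q^(k+1)` for some
such `Q`, with `k = q^(d-e)` and `e * k ≥ d` (`exists_pow_dvd_of_smarandache_ne`).

Take `m = ⌊√n⌋`. An exceptional `f` then has all prime factors of degree at most `m`, or is
divisible by a high prime power of degree at least `m + 1 + e` (`exceptionalSet_subset`). Rankin's
method bounds the first class by about `q^n * exp(-0.9 √n)` (`card_smoothMonics_le`). A union bound
gives at most `n * q^(n-m-1)` for the second (`card_biUnion_pow_dvd_le`). Both estimates hold for
every `q ≥ 2`. The density statement follows by passing from monic polynomials to their scalar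
multiples. -/

namespace CarlitzSmarandache

/-! ### Divisibility of `(t^d)!` and the shape of exceptional polynomials -/

section Factorial

variable {F : Type*} [Field F] [Fintype F] (a : Enumeration F)

theorem delta_lt_pow_iff {f : F[X]} {n : ℕ} :
    delta a f < Fintype.card F ^ n ↔ f.degree < n := by
  refine ⟨fun h => ?_, delta_lt_pow a⟩
  rcases eq_or_ne f 0 with rfl | hf
  · simp
  · refine (natDegree_lt_iff_degree_lt hf).1 ?_
    exact (Nat.pow_lt_pow_iff_right Fintype.one_lt_card).1 ((pow_le_delta a hf).trans_lt h)

theorem delta_X_pow (d : ℕ) : delta a (X ^ d : F[X]) = Fintype.card F ^ d := by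
  rw [delta, natDegree_X_pow, Finset.sum_range_succ, Finset.sum_eq_zero]
  · simp [digit_one]
  · intro i hi
    have : i ≠ d := (Finset.mem_range.1 hi).ne
    simp [coeff_X_pow, this, digit_zero]

theorem finite_setOf_monic_natDegree_eq (F : Type*) [Field F] [Fintype F] (n : ℕ) :
    {f : F[X] | f.Monic ∧ f.natDegree = n}.Finite := by
  refine (finite_degree_lt (F := F) (n + 1)).subset fun f hf => ?_
  refine degree_le_natDegree.trans_lt ?_
  rw [hf.2]
  exact_mod_cast Nat.lt_succ_self n

/-- The finite set of monic polynomials of degree `n`. -/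
noncomputable def monics (F : Type*) [Field F] [Fintype F] (n : ℕ) : Finset F[X] :=
  (finite_setOf_monic_natDegree_eq F n).toFinset

theorem mem_monics {f : F[X]} {n : ℕ} : f ∈ monics F n ↔ f.Monic ∧ f.natDegree = n := by
  simp [monics]

theorem card_monics (n : ℕ) : (monics F n).card = Fintype.card F ^ n := by
  rw [monics, ← Set.ncard_eq_toFinset_card _ (finite_setOf_monic_natDegree_eq F n)]
  change Nat.card {f : F[X] // f.Monic ∧ f.natDegree = n} = _
  rw [Nat.card_congr (monicEquivDegreeLT n), Nat.card_congr (degreeLTEquiv F n).toEquiv]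
  simp

/-- The polynomials below `t^d` are those of degree less than `d`, and `g ↦ t^d - g` maps them
bijectively onto the monics of degree `d`. -/
theorem polyFactorial_X_pow (d : ℕ) : polyFactorial a (X ^ d : F[X]) = ∏ m ∈ monics F d, m := by
  refine Finset.prod_bij' (fun g _ => X ^ d - g) (fun m _ => X ^ d - m) ?_ ?_ ?_ ?_ ?_
  · intro g hg
    have hg' : g.degree < d := by
      simpa [delta_X_pow, delta_lt_pow_iff] using hg
    refine mem_monics.2 ⟨monic_X_pow_sub hg', ?_⟩
    rw [natDegree_eq_of_degree_eq (degree_sub_eq_left_of_degree_lt (by simpa using hg'))]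
    simp
  · intro m hm
    obtain ⟨h1, h2⟩ := mem_monics.1 hm
    simp only [Set.Finite.mem_toFinset, Set.mem_ofPred_eq, delta_X_pow, delta_lt_pow_iff]
    have h3 : (X ^ d : F[X]).degree = m.degree := by
      rw [degree_X_pow, degree_eq_natDegree h1.ne_zero, h2]
    have := degree_sub_lt_left h3 (by simp) (by simp [h1.leadingCoeff])
    simpa using this
  · simp
  · simp
  · simp

theorem monic_mul_mem_monics {P m : F[X]} (hP : P.Monic) {k : ℕ} (hm : m ∈ monics F k) :
    P * m ∈ monics F (P.natDegree + k) := by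
  obtain ⟨h1, rfl⟩ := mem_monics.1 hm
  exact mem_monics.2 ⟨hP.mul h1, hP.natDegree_mul h1⟩

/-- Among the monics of degree `d` are the multiples `P * m`, one for each of the `q^(d - deg P)`
monic `m` of complementary degree; each contributes a factor `P`. -/
theorem pow_dvd_polyFactorial_X_pow {P : F[X]} (hP : P.Monic) {d : ℕ} (hd : P.natDegree ≤ d) :
    P ^ Fintype.card F ^ (d - P.natDegree) ∣ polyFactorial a (X ^ d : F[X]) := by
  classical
  rw [polyFactorial_X_pow, ← card_monics, ← Finset.prod_const]
  refine (Dvd.intro (∏ m ∈ monics F (d - P.natDegree), m) rfl).trans ?_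
  rw [← Finset.prod_mul_distrib]
  have hinj : Set.InjOn (fun m => P * m) (monics F (d - P.natDegree) : Set F[X]) :=
    fun x _ y _ h => mul_left_cancel₀ hP.ne_zero h
  rw [← Finset.prod_image (f := fun m : F[X] => m) hinj]
  refine Finset.prod_dvd_prod_of_subset _ _ _ fun x hx => ?_
  obtain ⟨m, hm, rfl⟩ := Finset.mem_image.1 hx
  have := monic_mul_mem_monics hP hm
  rwa [Nat.add_sub_of_le hd] at this

theorem smarandache_eq_X_pow {f P : F[X]} (hf : f ≠ 0) (hP : Irreducible P) (hPf : P ∣ f)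
    (h : f ∣ polyFactorial a (X ^ P.natDegree : F[X])) :
    smarandache a f = X ^ P.natDegree := by
  rw [smarandache, dif_neg hf]
  have hmem := Function.argminOn_mem (delta a) _ (exists_dvd_polyFactorial a hf)
  have hle := Function.argminOn_le (delta a) {g : F[X] | f ∣ polyFactorial a g} h
  set s := Function.argminOn (delta a) {g : F[X] | f ∣ polyFactorial a g}
    (exists_dvd_polyFactorial a hf)
  refine delta_injective a (le_antisymm hle ?_)
  rw [delta_X_pow]
  by_contra! hlt
  -- If `s < t^(deg P)`, the prime `P` divides a nonzero factor `s - g` of degree less than `deg P`.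
  obtain ⟨g, hg, hPg⟩ := (hP.prime.dvd_finsetProd_iff _).1 (hPf.trans hmem)
  have hgs : delta a g < delta a s := by simpa using hg
  have h0 : s - g ≠ 0 := sub_ne_zero.2 fun e => by simp [e] at hgs
  have h1 := degree_le_of_dvd hPg h0
  have h2 := (degree_sub_le s g).trans_lt
    (max_lt ((delta_lt_pow_iff a).1 hlt) ((delta_lt_pow_iff a).1 (hgs.trans hlt)))
  rw [degree_eq_natDegree hP.ne_zero] at h1
  exact absurd h2 (not_lt.2 h1)

omit [Fintype F] in
theorem exists_monic_associated {p : F[X]} (hp : p ≠ 0) : ∃ m : F[X], m.Monic ∧ Associated m p := by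
  refine ⟨_, monic_mul_leadingCoeff_inv hp, associated_mul_unit_left _ _ ?_⟩
  exact isUnit_C.2 (inv_ne_zero (leadingCoeff_ne_zero.2 hp)).isUnit

omit [Fintype F] in
theorem exists_pow_dvd_not_dvd {f g : F[X]} (hf : f ≠ 0) (h : ¬ f ∣ g) :
    ∃ P : F[X], ∃ k : ℕ, P.Monic ∧ Irreducible P ∧ P ^ k ∣ f ∧ ¬ P ^ k ∣ g := by
  rw [UniqueFactorizationMonoid.dvd_iff_emultiplicity_le hf] at h
  push Not at h
  obtain ⟨p, hp, hlt⟩ := h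
  have hfin : FiniteMultiplicity p f := FiniteMultiplicity.of_prime_left hp hf
  obtain ⟨m, hm, hass⟩ := exists_monic_associated hp.ne_zero
  have hgk : ¬ p ^ multiplicity p f ∣ g := by
    rw [pow_dvd_iff_le_emultiplicity, ← hfin.emultiplicity_eq_multiplicity]
    exact not_le.2 hlt
  refine ⟨m, multiplicity p f, hm,
    hass.symm.irreducible hp.irreducible, ?_, ?_⟩
  · rw [(hass.pow_pow).dvd_iff_dvd_left]
    exact pow_multiplicity_dvd p f
  · rwa [(hass.pow_pow).dvd_iff_dvd_left]

theorem le_mul_pow_sub (q e d : ℕ) (hq : 1 < q) (he : 0 < e) (h : e ≤ d) :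
    d ≤ e * q ^ (d - e) := by
  have h1 : d - e < q ^ (d - e) := Nat.lt_pow_self hq
  calc d = e + (d - e) := by omega
    _ ≤ e + e * (d - e) := by gcongr; exact Nat.le_mul_of_pos_left _ he
    _ = e * (d - e + 1) := by ring
    _ ≤ _ := Nat.mul_le_mul_left _ h1

/-- If `S(f) ≠ t ^ d` with `d` the largest degree of a prime factor, then `f` is divisible by a
prime power whose exponent exceeds `1` by a large amount. -/
theorem exists_pow_dvd_of_smarandache_ne {f P : F[X]} (hf : f ≠ 0) (hP : Irreducible P)
    (hPf : P ∣ f) (hmax : ∀ Q : F[X], Q.Monic → Irreducible Q → Q ∣ f → Q.natDegree ≤ P.natDegree)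
    (h : smarandache a f ≠ X ^ P.natDegree) :
    ∃ Q : F[X], ∃ k : ℕ, Q.Monic ∧ Irreducible Q ∧ Q ^ (k + 1) ∣ f ∧
      P.natDegree ≤ Q.natDegree * k := by
  obtain ⟨Q, k, hQm, hQ, h1, h2⟩ := exists_pow_dvd_not_dvd hf
    (fun hdvd => h (smarandache_eq_X_pow a hf hP hPf hdvd))
  have hk : k ≠ 0 := by rintro rfl; simp at h2
  have hd := hmax Q hQm hQ ((dvd_pow_self Q hk).trans h1)
  have h3 : Fintype.card F ^ (P.natDegree - Q.natDegree) < k := by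
    by_contra! hle
    exact h2 ((pow_dvd_pow Q hle).trans (pow_dvd_polyFactorial_X_pow a hQm hd))
  -- The witness is `q^(deg P - deg Q)`, the multiplicity guaranteed in the factorial.
  exact ⟨Q, _, hQm, hQ, (pow_dvd_pow Q h3).trans h1,
    le_mul_pow_sub _ _ _ Fintype.one_lt_card hQ.natDegree_pos hd⟩

theorem isLargestPrimeFactor_largestPrimeFactor {f : F[X]} (hf : 0 < f.natDegree) :
    IsLargestPrimeFactor a f (largestPrimeFactor a f) := by
  rw [largestPrimeFactor, dif_pos hf]
  exact (exists_isLargestPrimeFactor a hf).choose_spec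

theorem natDegree_le_natDegree_of_delta_le {f g : F[X]}
    (h : delta a f ≤ delta a g) : f.natDegree ≤ g.natDegree := by
  have h1 : delta a g < Fintype.card F ^ (g.natDegree + 1) := by
    refine delta_lt_pow a (degree_le_natDegree.trans_lt ?_)
    exact_mod_cast Nat.lt_succ_self _
  have h2 := (delta_lt_pow_iff a).1 (h.trans_lt h1)
  rcases eq_or_ne f 0 with rfl | hf
  · simp
  · exact Nat.lt_succ_iff.1 ((natDegree_lt_iff_degree_lt hf).2 h2)

theorem IsLargestPrimeFactor.natDegree_le {f P Q : F[X]} (h : IsLargestPrimeFactor a f P)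
    (hQ : Irreducible Q) (hQf : Q ∣ f) : Q.natDegree ≤ P.natDegree := by
  obtain ⟨m, hm, hass⟩ := exists_monic_associated hQ.ne_zero
  have := h.2.2.2 m hm
    (hass.symm.irreducible hQ) (hass.dvd_iff_dvd_left.2 hQf)
  have := natDegree_le_natDegree_of_delta_le a this
  rwa [natDegree_eq_of_degree_eq (degree_eq_degree_of_associated hass)] at this

end Factorial

end CarlitzSmarandache

namespace CarlitzSmarandache

/-! ### Prime counting and Rankin's bound for smooth polynomials -/

section Counting

variable {F : Type*} [Field F] [Fintype F]

open Classical in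
theorem card_filter_dvd_mul_le {P : F[X]} (hP : P.Monic) (n : ℕ) :
    ({f ∈ monics F n | P ∣ f}).card * Fintype.card F ^ P.natDegree ≤ Fintype.card F ^ n := by
  by_cases h : P.natDegree ≤ n
  · have hsub : {f ∈ monics F n | P ∣ f} ⊆
        (monics F (n - P.natDegree)).image (fun m => P * m) := by
      intro f hf
      obtain ⟨hfm, m, rfl⟩ := Finset.mem_filter.1 hf
      obtain ⟨h1, h2⟩ := mem_monics.1 hfm
      have hm : m.Monic := hP.of_mul_monic_left h1
      rw [hP.natDegree_mul hm] at h2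
      exact Finset.mem_image_of_mem _ (mem_monics.2 ⟨hm, by omega⟩)
    have hcard := (Finset.card_le_card hsub).trans Finset.card_image_le
    rw [card_monics] at hcard
    refine (Nat.mul_le_mul_right _ hcard).trans_eq ?_
    rw [← pow_add, Nat.sub_add_cancel h]
  · rw [Finset.filter_false_of_mem, Finset.card_empty, zero_mul]
    · positivity
    · intro f hf hdvd
      obtain ⟨h1, h2⟩ := mem_monics.1 hf
      exact h (h2 ▸ natDegree_le_of_dvd hdvd h1.ne_zero)

open Classical in
/-- The monic irreducible polynomials of degree `e`. -/
noncomputable def primesOfDegree (F : Type*) [Field F] [Fintype F] (e : ℕ) : Finset F[X] :=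
  {f ∈ monics F e | Irreducible f}

theorem mem_primesOfDegree {P : F[X]} {e : ℕ} :
    P ∈ primesOfDegree F e ↔ (P.Monic ∧ P.natDegree = e) ∧ Irreducible P := by
  simp [primesOfDegree, mem_monics]

omit [Fintype F] in
theorem isCoprime_of_monic_irreducible {P Q : F[X]} (hP : P.Monic) (hQ : Q.Monic)
    (hP' : Irreducible P) (hQ' : Irreducible Q) (h : P ≠ Q) : IsCoprime P Q :=
  (hP'.coprime_iff_not_dvd).2 fun hdvd =>
    h (eq_of_monic_of_associated hP hQ (hP'.associated_of_dvd hQ' hdvd))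

/-- Distinct monic primes of degree `e` are coprime and all divide `X^(q^e) - X`; compare degrees.
-/
theorem card_primesOfDegree_mul_le (e : ℕ) :
    (primesOfDegree F e).card * e ≤ Fintype.card F ^ e := by
  rcases Nat.eq_zero_or_pos e with rfl | he
  · simp
  have hq : 1 < Fintype.card F := Fintype.one_lt_card
  have hdvd : ∏ P ∈ primesOfDegree F e, P ∣ (X ^ Fintype.card F ^ e - X : F[X]) := by
    refine Finset.prod_dvd_of_coprime (fun P hP Q hQ h => ?_) fun P hP => ?_
    · obtain ⟨⟨h1, -⟩, h2⟩ := mem_primesOfDegree.1 hP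
      obtain ⟨⟨h3, -⟩, h4⟩ := mem_primesOfDegree.1 hQ
      exact isCoprime_of_monic_irreducible h1 h3 h2 h4 h
    · obtain ⟨⟨h1, h2⟩, h3⟩ := mem_primesOfDegree.1 hP
      have := h3.natDegree_dvd_iff_dvd_X_pow_card_pow_sub_X.1 h2.dvd
      rwa [Nat.card_eq_fintype_card] at this
  have hdeg := natDegree_le_of_dvd hdvd
    (FiniteField.X_pow_card_pow_sub_X_ne_zero F he.ne' hq)
  rw [FiniteField.X_pow_card_pow_sub_X_natDegree_eq F he.ne' hq,
    natDegree_prod_of_monic _ _ fun P hP => (mem_primesOfDegree.1 hP).1.1,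
    Finset.sum_congr rfl fun P hP => (mem_primesOfDegree.1 hP).1.2] at hdeg
  simpa using hdeg

omit [Fintype F] in
theorem sum_multiplicity_mul_natDegree_le (S : Finset F[X])
    (hS : ∀ P ∈ S, P.Monic ∧ Irreducible P) {f : F[X]} (hf : f ≠ 0) :
    ∑ P ∈ S, multiplicity P f * P.natDegree ≤ f.natDegree := by
  have hdvd : ∏ P ∈ S, P ^ multiplicity P f ∣ f := by
    refine Finset.prod_dvd_of_coprime (fun P hP Q hQ h => ?_) fun P hP => pow_multiplicity_dvd P f
    exact (isCoprime_of_monic_irreducible (hS P hP).1 (hS Q hQ).1 (hS P hP).2 (hS Q hQ).2 h).pow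
  have := natDegree_le_of_dvd hdvd hf
  rwa [natDegree_prod_of_monic _ _ fun P hP => (hS P hP).1.pow _,
    Finset.sum_congr rfl fun P _ => natDegree_pow P (multiplicity P f)] at this

omit [Fintype F] in
theorem dvd_of_multiplicity_le {S : Set F[X]} {f g : F[X]} (hf : f ≠ 0)
    (hfS : ∀ P : F[X], P.Monic → Irreducible P → P ∣ f → P ∈ S)
    (h : ∀ P ∈ S, multiplicity P f ≤ multiplicity P g) : f ∣ g := by
  by_contra hn
  obtain ⟨P, k, hPm, hP, h1, h2⟩ := exists_pow_dvd_not_dvd hf hn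
  have hk : k ≠ 0 := by rintro rfl; simp at h2
  have hPS := hfS P hPm hP ((dvd_pow_self P hk).trans h1)
  have hfin : FiniteMultiplicity P f := FiniteMultiplicity.of_prime_left hP.prime hf
  exact h2 ((pow_dvd_pow P ((hfin.le_multiplicity_of_pow_dvd h1).trans (h P hPS))).trans
    (pow_multiplicity_dvd P g))

open Classical in
/-- Rankin's bound for the number of monic polynomials of degree `n` all of whose prime factors
lie in a given finite set. -/
theorem card_filter_mul_pow_le_prod (S : Finset F[X]) (hS : ∀ P ∈ S, P.Monic ∧ Irreducible P)
    (n : ℕ) {x : ℝ} (hx0 : 0 ≤ x) (hx1 : x ≤ 1) :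
    ({f ∈ monics F n | ∀ P : F[X], P.Monic → Irreducible P → P ∣ f → P ∈ S}).card * x ^ n ≤
      ∏ P ∈ S, ∑ k ∈ Finset.range (n + 1), (x ^ P.natDegree) ^ k := by
  set A := {f ∈ monics F n | ∀ P : F[X], P.Monic → Irreducible P → P ∣ f → P ∈ S} with hA
  have hmem : ∀ f ∈ A, f.Monic ∧ f.natDegree = n ∧
      ∀ P : F[X], P.Monic → Irreducible P → P ∣ f → P ∈ S := fun f hf => by
    simpa [hA, mem_monics, and_assoc] using hf
  -- A monic polynomial with all prime factors in `S` is determined by its vector of multiplicities,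
  -- whose entries are at most `n`. The sum over polynomials thus embeds in a sum over a box, which
  -- factors as a product.
  let φ : F[X] → (S → ℕ) := fun f P => multiplicity P.1 f
  have hinj : Set.InjOn φ (A : Set F[X]) := by
    intro f hf g hg h
    obtain ⟨hf1, -, hf2⟩ := hmem f hf
    obtain ⟨hg1, -, hg2⟩ := hmem g hg
    refine eq_of_monic_of_associated hf1 hg1 (associated_of_dvd_dvd ?_ ?_)
    · exact dvd_of_multiplicity_le (S := S) hf1.ne_zero hf2
        fun P hP => (congrFun h ⟨P, hP⟩).le
    · exact dvd_of_multiplicity_le (S := S) hg1.ne_zero hg2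
        fun P hP => (congrFun h ⟨P, hP⟩).ge
  have hdeg : ∀ f ∈ A, ∑ P : S, φ f P * P.1.natDegree ≤ n := fun f hf => by
    obtain ⟨h1, h2, -⟩ := hmem f hf
    have := sum_multiplicity_mul_natDegree_le S hS h1.ne_zero
    rwa [h2, ← Finset.sum_coe_sort] at this
  have hsub : A.image φ ⊆ Fintype.piFinset fun _ : S => Finset.range (n + 1) := by
    intro ψ hψ
    obtain ⟨f, hf, rfl⟩ := Finset.mem_image.1 hψ
    refine Fintype.mem_piFinset.2 fun P => Finset.mem_range_succ_iff.2 ?_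
    refine le_trans ?_ (hdeg f hf)
    refine (Nat.le_mul_of_pos_right _ (hS P.1 P.2).2.natDegree_pos).trans ?_
    exact Finset.single_le_sum (f := fun P : S => φ f P * P.1.natDegree)
      (fun _ _ => Nat.zero_le _) (Finset.mem_univ P)
  calc (A.card : ℝ) * x ^ n = ∑ f ∈ A, x ^ n := by simp
    _ ≤ ∑ f ∈ A, ∏ P : S, (x ^ P.1.natDegree) ^ φ f P := by
      refine Finset.sum_le_sum fun f hf => ?_
      simp_rw [← pow_mul, Finset.prod_pow_eq_pow_sum, mul_comm _ (φ f _)]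
      exact pow_le_pow_of_le_one hx0 hx1 (hdeg f hf)
    _ = ∑ ψ ∈ A.image φ, ∏ P : S, (x ^ P.1.natDegree) ^ ψ P := by
      rw [Finset.sum_image hinj]
    _ ≤ ∑ ψ ∈ Fintype.piFinset fun _ : S => Finset.range (n + 1),
          ∏ P : S, (x ^ P.1.natDegree) ^ ψ P :=
      Finset.sum_le_sum_of_subset_of_nonneg hsub fun _ _ _ => by positivity
    _ = ∏ P : S, ∑ k ∈ Finset.range (n + 1), (x ^ P.1.natDegree) ^ k :=
      (Finset.prod_univ_sum (fun _ : S => Finset.range (n + 1))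
        fun P k => (x ^ P.1.natDegree) ^ k).symm
    _ = _ := Finset.prod_coe_sort S fun P => ∑ k ∈ Finset.range (n + 1), (x ^ P.natDegree) ^ k

/-- The hypothesis says `1/(1-u) ≤ c`, so `1/(1-u) = 1 + u/(1-u) ≤ 1 + c*u ≤ exp(c*u)`. -/
theorem geom_sum_le_exp {u c : ℝ} (hu : 0 ≤ u) (hc : 0 < c) (huc : u ≤ 1 - 1 / c) (n : ℕ) :
    ∑ k ∈ Finset.range n, u ^ k ≤ Real.exp (c * u) := by
  have hc' : 0 < 1 / c := by positivity
  have hu1 : u < 1 := by linarith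
  have h1 : ∑ k ∈ Finset.range n, u ^ k ≤ (1 - u)⁻¹ := by
    rw [← tsum_geometric_of_lt_one hu hu1]
    exact (summable_geometric_of_lt_one hu hu1).sum_le_tsum _ fun _ _ => by positivity
  have h2 : (1 - u)⁻¹ ≤ c := by
    rw [inv_le_comm₀ (by linarith) hc, ← one_div]
    linarith
  have h3 : (1 - u)⁻¹ = (1 - u)⁻¹ * u + 1 := by
    have : 1 - u ≠ 0 := by linarith
    field_simp
    ring
  calc _ ≤ (1 - u)⁻¹ * u + 1 := h1.trans_eq h3
    _ ≤ c * u + 1 := by gcongr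
    _ ≤ _ := Real.add_one_le_exp _

open Classical in
/-- The monic polynomials of degree `n` all of whose prime factors have degree at most `m`. -/
noncomputable def smoothMonics (F : Type*) [Field F] [Fintype F] (n m : ℕ) : Finset F[X] :=
  {f ∈ monics F n | ∀ P : F[X], P.Monic → Irreducible P → P ∣ f → P.natDegree ≤ m}

theorem mem_smoothMonics {f : F[X]} {n m : ℕ} : f ∈ smoothMonics F n m ↔ f ∈ monics F n ∧
    ∀ P : F[X], P.Monic → Irreducible P → P ∣ f → P.natDegree ≤ m := by
  simp [smoothMonics]

/-- Rankin's product is turned into an exponential factor by factor; the primes are then grouped by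
degree, with at most `q^e / e` of degree `e`. -/
theorem card_smoothMonics_mul_pow_le (n m : ℕ) {x c : ℝ} (hx : 0 ≤ x) (hc : 0 < c)
    (hxc : x ≤ 1 - 1 / c) :
    (smoothMonics F n m).card * x ^ n ≤
      Real.exp (c * ∑ e ∈ Finset.Icc 1 m, (Fintype.card F * x) ^ e / e) := by
  classical
  have hc' : 0 < 1 / c := by positivity
  have hx1 : x ≤ 1 := by linarith
  set S := (Finset.Icc 1 m).biUnion (primesOfDegree F) with hSdef
  have hmemS : ∀ P, P ∈ S ↔ P.Monic ∧ Irreducible P ∧ P.natDegree ≤ m := by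
    intro P
    simp only [hSdef, Finset.mem_biUnion, mem_primesOfDegree, Finset.mem_Icc]
    constructor
    · rintro ⟨e, ⟨-, he⟩, ⟨h1, rfl⟩, h2⟩
      exact ⟨h1, h2, he⟩
    · rintro ⟨h1, h2, h3⟩
      exact ⟨_, ⟨h2.natDegree_pos, h3⟩, ⟨h1, rfl⟩, h2⟩
  have hS : ∀ P ∈ S, P.Monic ∧ Irreducible P := fun P hP =>
    ⟨((hmemS P).1 hP).1, ((hmemS P).1 hP).2.1⟩
  have hsmooth : smoothMonics F n m =
      {f ∈ monics F n | ∀ P : F[X], P.Monic → Irreducible P → P ∣ f → P ∈ S} := by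
    ext f
    simp only [mem_smoothMonics, Finset.mem_filter, hmemS]
    exact and_congr_right fun _ => forall_congr' fun P => by tauto
  rw [hsmooth]
  calc _ ≤ ∏ P ∈ S, ∑ k ∈ Finset.range (n + 1), (x ^ P.natDegree) ^ k :=
        card_filter_mul_pow_le_prod S hS n hx hx1
    _ ≤ ∏ P ∈ S, Real.exp (c * x ^ P.natDegree) := by
        refine Finset.prod_le_prod (fun _ _ => by positivity) fun P hP => ?_
        refine geom_sum_le_exp (by positivity) hc (le_trans ?_ hxc) _
        exact pow_le_of_le_one hx hx1 (hS P hP).2.natDegree_pos.ne'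
    _ = Real.exp (c * ∑ P ∈ S, x ^ P.natDegree) := by
        rw [← Real.exp_sum, Finset.mul_sum]
    _ ≤ _ := by
        gcongr
        rw [hSdef, Finset.sum_biUnion]
        · refine Finset.sum_le_sum fun e he => ?_
          have he0 : (0 : ℝ) < e := by exact_mod_cast (Finset.mem_Icc.1 he).1
          have hcard : ((primesOfDegree F e).card : ℝ) * e ≤ (Fintype.card F : ℝ) ^ e := by
            exact_mod_cast card_primesOfDegree_mul_le (F := F) e
          rw [Finset.sum_congr rfl fun P hP => by rw [(mem_primesOfDegree.1 hP).1.2],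
            Finset.sum_const, nsmul_eq_mul, le_div_iff₀ he0, mul_pow]
          calc _ = ((primesOfDegree F e).card : ℝ) * e * x ^ e := by ring
            _ ≤ _ := by gcongr
        · intro e _ e' _ hne
          refine Finset.disjoint_left.2 fun P h1 h2 => hne ?_
          rw [← (mem_primesOfDegree.1 h1).1.2, (mem_primesOfDegree.1 h2).1.2]

end Counting

end CarlitzSmarandache

namespace CarlitzSmarandache

/-! ### Explicit bounds for the exceptional set -/

section Bounds

variable {F : Type*} [Field F] [Fintype F] (a : Enumeration F)

/-- Tangent line of the logarithm at `57 = √3249`, with `log 57 ≤ 6 log 2`. -/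
theorem log_le_div_add {s : ℝ} (hs : 0 < s) : Real.log s ≤ s / 57 + 3.16 := by
  have h1 := Real.log_le_sub_one_of_pos (show 0 < s / 57 by positivity)
  rw [Real.log_div hs.ne' (by norm_num)] at h1
  have h2 : Real.log 57 ≤ Real.log ((2 : ℝ) ^ 6) := Real.log_le_log (by norm_num) (by norm_num)
  rw [Real.log_pow] at h2
  have h3 := Real.log_two_lt_d9
  norm_num at h2 ⊢
  linarith

theorem sum_Icc_pow_div_le {y C : ℝ} (m : ℕ) (hC : ∀ e ≤ m, y ^ e ≤ C) (hC0 : 0 ≤ C) :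
    ∑ e ∈ Finset.Icc 1 m, y ^ e / e ≤ C * (1 + Real.log m) := by
  have h1 : (harmonic m : ℝ) = ∑ e ∈ Finset.Icc 1 m, (e : ℝ)⁻¹ := by
    rw [harmonic_eq_sum_Icc]
    push_cast
    rfl
  calc _ ≤ ∑ e ∈ Finset.Icc 1 m, C * (e : ℝ)⁻¹ := by
        refine Finset.sum_le_sum fun e he => ?_
        rw [div_eq_mul_inv]
        gcongr
        exact hC e (Finset.mem_Icc.1 he).2
    _ = C * harmonic m := by rw [h1, Finset.mul_sum]
    _ ≤ _ := by
        gcongr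
        exact harmonic_le_one_add_log m

theorem card_smoothMonics_le {n : ℕ} {s : ℝ} (hs : 57 ≤ s) (hn : s ^ 2 = n) :
    ((smoothMonics F n ⌊s⌋₊).card : ℝ) ≤
      (Fintype.card F : ℝ) ^ n * Real.exp (-(0.902 * s) + 23.1) := by
  have hs0 : 0 ≤ s := by linarith
  set m := ⌊s⌋₊ with hm
  have hms : (m : ℝ) ≤ s := Nat.floor_le hs0
  have hm57 : (57 : ℝ) ≤ m := by exact_mod_cast Nat.le_floor (by exact_mod_cast hs)
  have hm0 : (0 : ℝ) < m := by linarith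
  have hq : (2 : ℝ) ≤ Fintype.card F := by exact_mod_cast Fintype.one_lt_card (α := F)
  have hq0 : (0 : ℝ) < Fintype.card F := by linarith
  -- Rankin's parameter is `x = y / q`: this `y` keeps `y^e ≤ exp 1` for all `e ≤ m`, while `y^n =
  -- exp(n/m) ≥ exp s`.
  set y := Real.exp (1 / m) with hy
  have hy1 : y ≤ 57 / 56 := by
    have h1 : y ≤ Real.exp (1 / 57) := Real.exp_le_exp.2 (by gcongr)
    have h2 := Real.one_sub_le_exp_neg (1 / 57)
    rw [Real.exp_neg, le_inv_comm₀ (by norm_num) (Real.exp_pos _)] at h2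
    refine h1.trans (h2.trans (by norm_num))
  have hxc : y / Fintype.card F ≤ 1 - 1 / 2.04 := by
    calc y / Fintype.card F ≤ (57 / 56) / 2 := by gcongr
      _ ≤ _ := by norm_num
  have hmain := card_smoothMonics_mul_pow_le (F := F) n m (x := y / Fintype.card F) (c := 2.04)
    (by positivity) (by norm_num) hxc
  rw [mul_div_cancel₀ _ hq0.ne'] at hmain
  have hsum := sum_Icc_pow_div_le (y := y) (C := 2.7183) m (fun e he => by
    rw [hy, ← Real.exp_nat_mul]
    have h1 : (e : ℝ) * (1 / m) ≤ 1 := by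
      rw [mul_one_div, div_le_one hm0]
      exact_mod_cast he
    refine (Real.exp_le_exp.2 h1).trans ?_
    linarith [Real.exp_one_lt_d9]) (by norm_num)
  have hlog : Real.log m ≤ s / 57 + 3.16 :=
    (Real.log_le_log hm0 hms).trans (log_le_div_add (by linarith))
  have hyn : y ^ n = Real.exp (n / m) := by rw [hy, ← Real.exp_nat_mul, mul_one_div]
  have hnm : s ≤ n / m := by
    rw [le_div_iff₀ hm0, ← hn, sq]
    gcongr
  rw [div_pow, mul_div_assoc', div_le_iff₀ (by positivity), hyn] at hmain
  have hfin : ((smoothMonics F n m).card : ℝ) ≤ Real.exp (2.04 * (∑ e ∈ Finset.Icc 1 m, y ^ e / e)) *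
      (Fintype.card F : ℝ) ^ n * Real.exp (-(n / m)) := by
    rw [Real.exp_neg, ← div_eq_mul_inv, le_div_iff₀ (Real.exp_pos _)]
    exact hmain
  refine hfin.trans ?_
  rw [mul_comm (Real.exp _), mul_assoc, ← Real.exp_add]
  -- Here `2.04 * 2.7183 * (1 + s/57 + 3.16) ≤ 0.098 * s + 23.1`, against the gain `-s`.
  refine mul_le_mul_of_nonneg_left (Real.exp_le_exp.2 ?_) (by positivity)
  norm_num at hsum hlog ⊢
  linarith

open Classical in
theorem exceptionalSet_subset {n : ℕ} (hn : 0 < n) (m : ℕ) :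
    exceptionalSet a n ⊆ ((smoothMonics F n m ∪ (Finset.Icc 1 n).biUnion fun e =>
      (primesOfDegree F e).biUnion fun P => {f ∈ monics F n | P ^ (m / e + 2) ∣ f} :
        Finset F[X]) : Set F[X]) := by
  rintro f ⟨h1, h2, h3⟩
  have hP := isLargestPrimeFactor_largestPrimeFactor a (h2.symm ▸ hn : 0 < f.natDegree)
  have hmax : ∀ Q : F[X], Q.Monic → Irreducible Q → Q ∣ f →
      Q.natDegree ≤ (largestPrimeFactor a f).natDegree := fun Q _ h h' => hP.natDegree_le a h h'
  have hfn : f ∈ monics F n := mem_monics.2 ⟨h1, h2⟩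
  rw [Finset.mem_coe, Finset.mem_union]
  by_cases hd : (largestPrimeFactor a f).natDegree ≤ m
  · exact Or.inl (mem_smoothMonics.2 ⟨hfn, fun Q h h' h'' => (hmax Q h h' h'').trans hd⟩)
  · right
    obtain ⟨Q, k, hQm, hQ, hQf, hk⟩ :=
      exists_pow_dvd_of_smarandache_ne a h1.ne_zero hP.2.1 hP.2.2.1 hmax h3
    refine Finset.mem_biUnion.2 ⟨Q.natDegree, Finset.mem_Icc.2 ⟨hQ.natDegree_pos, ?_⟩,
      Finset.mem_biUnion.2 ⟨Q, mem_primesOfDegree.2 ⟨⟨hQm, rfl⟩, hQ⟩,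
        Finset.mem_filter.2 ⟨hfn, (pow_dvd_pow Q ?_).trans hQf⟩⟩⟩
    · exact h2 ▸ natDegree_le_of_dvd ((dvd_pow_self Q k.succ_ne_zero).trans hQf) h1.ne_zero
    -- Since `deg Q * k ≥ d > m`, the exponent `k + 1` is at least `⌊m / deg Q⌋ + 2`.
    · have : m / Q.natDegree < k := by
        rw [Nat.div_lt_iff_lt_mul hQ.natDegree_pos, mul_comm]
        omega
      omega

open Classical in
theorem card_biUnion_pow_dvd_le (n m : ℕ) :
    (((Finset.Icc 1 n).biUnion fun e => (primesOfDegree F e).biUnion fun P =>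
      {f ∈ monics F n | P ^ (m / e + 2) ∣ f}).card : ℝ) ≤
      n * ((Fintype.card F : ℝ) ^ n / (Fintype.card F : ℝ) ^ (m + 1)) := by
  have hq : (1 : ℝ) ≤ Fintype.card F := by exact_mod_cast Fintype.card_pos (α := F)
  have hq0 : (0 : ℝ) < Fintype.card F := by linarith
  have hP : ∀ e ∈ Finset.Icc 1 n, ∀ P ∈ primesOfDegree F e,
      ((({f ∈ monics F n | P ^ (m / e + 2) ∣ f}).card : ℕ) : ℝ) ≤
        (Fintype.card F : ℝ) ^ n / (Fintype.card F : ℝ) ^ (m + 1) / (Fintype.card F : ℝ) ^ e := by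
    intro e he P hP
    obtain ⟨⟨h1, h2⟩, -⟩ := mem_primesOfDegree.1 hP
    have h3 := card_filter_dvd_mul_le (h1.pow (m / e + 2)) n
    rw [div_div, ← pow_add, le_div_iff₀ (by positivity)]
    -- From `m < e * ⌊m/e⌋ + e`. The spare `e` in the degree pays for the at most `q^e` primes of
    -- degree `e`.
    have h4 : m + 1 + e ≤ (P ^ (m / e + 2)).natDegree := by
      rw [natDegree_pow, h2]
      have := Nat.lt_div_mul_add (a := m) (Finset.mem_Icc.1 he).1
      rw [add_mul]
      omega
    have h5 : ((({f ∈ monics F n | P ^ (m / e + 2) ∣ f}).card : ℕ) : ℝ) *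
        (Fintype.card F : ℝ) ^ (P ^ (m / e + 2)).natDegree ≤ (Fintype.card F : ℝ) ^ n := by
      exact_mod_cast h3
    refine le_trans ?_ h5
    gcongr
  have hE : ∀ e ∈ Finset.Icc 1 n, ((((primesOfDegree F e).biUnion fun P =>
      {f ∈ monics F n | P ^ (m / e + 2) ∣ f}).card : ℕ) : ℝ) ≤
        (Fintype.card F : ℝ) ^ n / (Fintype.card F : ℝ) ^ (m + 1) := by
    intro e he
    have h1 : ((primesOfDegree F e).card : ℝ) ≤ (Fintype.card F : ℝ) ^ e := by
      exact_mod_cast (Finset.card_filter_le _ _).trans_eq (card_monics (F := F) e)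
    calc _ ≤ ∑ P ∈ primesOfDegree F e, ((({f ∈ monics F n | P ^ (m / e + 2) ∣ f}).card : ℕ) : ℝ) :=
          by exact_mod_cast Finset.card_biUnion_le
      _ ≤ _ := Finset.sum_le_card_nsmul _ _ _ (hP e he)
      _ ≤ (Fintype.card F : ℝ) ^ e * ((Fintype.card F : ℝ) ^ n / (Fintype.card F : ℝ) ^ (m + 1) /
            (Fintype.card F : ℝ) ^ e) := by
          rw [nsmul_eq_mul]
          gcongr
      _ = _ := by field_simp
  calc _ ≤ ∑ e ∈ Finset.Icc 1 n, ((((primesOfDegree F e).biUnion fun P =>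
          {f ∈ monics F n | P ^ (m / e + 2) ∣ f}).card : ℕ) : ℝ) :=
        by exact_mod_cast Finset.card_biUnion_le
    _ ≤ _ := Finset.sum_le_card_nsmul _ _ _ hE
    _ = _ := by simp

theorem natCast_div_pow_le {n : ℕ} {s q : ℝ} (hs : 57 ≤ s) (hn : s ^ 2 = n) (hq : 2 ≤ q) :
    n * (q ^ n / q ^ (⌊s⌋₊ + 1)) ≤ q ^ n * Real.exp (-(0.657 * s) + 6.33) := by
  have hs0 : 0 < s := by linarith
  have h1 : Real.exp (Real.log 2 * s) ≤ q ^ (⌊s⌋₊ + 1) := by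
    calc _ ≤ Real.exp (Real.log 2 * ((⌊s⌋₊ + 1 : ℕ) : ℝ)) := by
          have : s ≤ ((⌊s⌋₊ + 1 : ℕ) : ℝ) := by exact_mod_cast (Nat.lt_floor_add_one s).le
          have := Real.log_pos one_lt_two
          gcongr
      _ = 2 ^ (⌊s⌋₊ + 1) := by
          rw [mul_comm, Real.exp_nat_mul, Real.exp_log (by norm_num)]
      _ ≤ _ := by gcongr
  have h2 : (n : ℝ) = Real.exp (2 * Real.log s) := by
    rw [← hn, two_mul, Real.exp_add, Real.exp_log hs0, sq]
  calc n * (q ^ n / q ^ (⌊s⌋₊ + 1)) ≤ n * (q ^ n / Real.exp (Real.log 2 * s)) := by gcongr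
    _ = q ^ n * Real.exp (2 * Real.log s - Real.log 2 * s) := by
        rw [Real.exp_sub, ← h2]
        ring
    _ ≤ _ := by
        have h3 := log_le_div_add hs0
        have h4 : 0.693 * s ≤ Real.log 2 * s := by
          gcongr
          linarith [Real.log_two_gt_d9]
        gcongr
        norm_num at h3 h4 ⊢
        linarith

theorem ncard_exceptionalSet_le {n : ℕ} {s : ℝ} (hs : 57 ≤ s) (hn : s ^ 2 = n) :
    ((exceptionalSet a n).ncard : ℝ) ≤ (Fintype.card F : ℝ) ^ n *
      (Real.exp (-(0.902 * s) + 23.1) + Real.exp (-(0.657 * s) + 6.33)) := by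
  classical
  have hn0 : 0 < n := by
    have : (0 : ℝ) < n := by rw [← hn]; positivity
    exact_mod_cast this
  have hq : (2 : ℝ) ≤ Fintype.card F := by exact_mod_cast Fintype.one_lt_card (α := F)
  have h1 := Set.ncard_le_ncard (exceptionalSet_subset a hn0 ⌊s⌋₊) (Finset.finite_toSet _)
  rw [Set.ncard_coe_finset] at h1
  have h2 := h1.trans (Finset.card_union_le _ _)
  refine (Nat.cast_le (α := ℝ).2 h2).trans ?_
  push_cast
  rw [mul_add]
  exact add_le_add (card_smoothMonics_le hs hn)
    ((card_biUnion_pow_dvd_le n ⌊s⌋₊).trans (natCast_div_pow_le hs hn hq))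

/-- Lowering both decay rates to `c` absorbs the additive constants `23.1` and `6.33` once `√n ≥ N`.
This leaves twice the exponential, and `4` in place of `2` gives strictness. -/
theorem ncard_exceptionalSet_lt {n : ℕ} {c N : ℝ} (hN : 57 ≤ N) (hn : N ^ 2 ≤ n)
    (hc1 : 23.1 ≤ (0.902 - c) * N) (hc2 : 6.33 ≤ (0.657 - c) * N) :
    ((exceptionalSet a n).ncard : ℝ) <
      4 * (Fintype.card F : ℝ) ^ n * Real.exp (-(c * Real.sqrt n)) := by
  have hq : (0 : ℝ) < Fintype.card F := by exact_mod_cast Fintype.card_pos (α := F)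
  have hs : N ≤ Real.sqrt n := Real.le_sqrt_of_sq_le hn
  have h1 : ∀ b d : ℝ, 0 < d → d ≤ (b - c) * N →
      Real.exp (-(b * Real.sqrt n) + d) ≤ Real.exp (-(c * Real.sqrt n)) := by
    intro b d hd hb
    have hb0 : 0 < b - c := pos_of_mul_pos_left (hd.trans_le hb) (by linarith)
    have := mul_le_mul_of_nonneg_left hs hb0.le
    refine Real.exp_le_exp.2 ?_
    linarith
  have h2 := ncard_exceptionalSet_le a (hN.trans hs) (Real.sq_sqrt (Nat.cast_nonneg n))
  calc _ ≤ _ := h2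
    _ ≤ (Fintype.card F : ℝ) ^ n *
          (Real.exp (-(c * Real.sqrt n)) + Real.exp (-(c * Real.sqrt n))) := by
        refine mul_le_mul_of_nonneg_left (add_le_add ?_ ?_) (by positivity)
        · exact h1 _ _ (by norm_num) hc1
        · exact h1 _ _ (by norm_num) hc2
    _ < _ := by
        have : 0 < (Fintype.card F : ℝ) ^ n * Real.exp (-(c * Real.sqrt n)) := by positivity
        linarith

end Bounds

end CarlitzSmarandache

namespace CarlitzSmarandache

/-! ### From monic polynomials to all polynomials of degree `n` -/

section Density

variable {F : Type*} [Field F] [Fintype F] (a : Enumeration F)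

theorem smarandache_eq_of_associated {f g : F[X]} (h : Associated f g) :
    smarandache a f = smarandache a g := by
  by_cases hf : f = 0
  · subst hf
    rw [(associated_zero_iff_eq_zero g).1 h.symm]
  · have hg : g ≠ 0 := fun h0 => hf ((associated_zero_iff_eq_zero f).1 (h0 ▸ h))
    have hset : {p : F[X] | f ∣ polyFactorial a p} = {p : F[X] | g ∣ polyFactorial a p} := by
      ext p
      exact h.dvd_iff_dvd_left
    simp only [smarandache, hf, hg, dif_neg, not_false_eq_true, hset]

/-- The polynomials of degree `n` for which `S(f) = t ^ d`, with `d` the largest degree of an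
irreducible factor of `f`. -/
def typicalSet (n : ℕ) : Set F[X] :=
  {f | f.degree = n ∧
    ∃ d : ℕ, IsGreatest {k : ℕ | ∃ P : F[X], Irreducible P ∧ P ∣ f ∧ P.natDegree = k} d ∧
      smarandache a f = X ^ d}

theorem finite_degree_eq (F : Type*) [Field F] [Fintype F] (n : ℕ) :
    {f : F[X] | f.degree = n}.Finite := by
  refine (finite_degree_lt (F := F) (n + 1)).subset fun f hf => ?_
  rw [Set.mem_ofPred_eq] at hf ⊢
  rw [hf]
  exact_mod_cast Nat.lt_succ_self n

theorem card_pow_le_ncard_degree_eq (n : ℕ) :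
    Fintype.card F ^ n ≤ {f : F[X] | f.degree = n}.ncard := by
  rw [← card_monics, ← Set.ncard_coe_finset]
  refine Set.ncard_le_ncard (fun f hf => ?_) (finite_degree_eq F n)
  obtain ⟨h1, h2⟩ := mem_monics.1 (Finset.mem_coe.1 hf)
  change f.degree = n
  rw [degree_eq_natDegree h1.ne_zero, h2]

/-- `S` and the degrees of prime factors depend only on the associate class, so an atypical `f` is a
scalar multiple of an exceptional monic. -/
theorem setOf_degree_eq_subset {n : ℕ} (hn : 0 < n) :
    {f : F[X] | f.degree = n} ⊆ typicalSet a n ∪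
      (fun p : F × F[X] => C p.1 * p.2) '' (Set.univ ×ˢ exceptionalSet a n) := by
  intro f hf
  have hf : f.degree = n := hf
  have hnat : f.natDegree = n := natDegree_eq_of_degree_eq_some hf
  have hf0 : f ≠ 0 := by rintro rfl; simp at hf
  have hl : f.leadingCoeff ≠ 0 := leadingCoeff_ne_zero.2 hf0
  have hm := monic_mul_leadingCoeff_inv hf0
  set m := f * C f.leadingCoeff⁻¹ with hmdef
  have hass : Associated m f :=
    associated_mul_unit_left _ _ (isUnit_C.2 (inv_ne_zero hl).isUnit)
  have hmn : m.natDegree = n := by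
    rw [← hnat, natDegree_eq_of_degree_eq (degree_eq_degree_of_associated hass)]
  by_cases hS : smarandache a m = X ^ (largestPrimeFactor a m).natDegree
  · left
    have hP := isLargestPrimeFactor_largestPrimeFactor a (hmn.symm ▸ hn : 0 < m.natDegree)
    refine ⟨hf, _, ⟨⟨_, hP.2.1, hP.2.2.1.trans hass.dvd, rfl⟩, ?_⟩,
      (smarandache_eq_of_associated a hass).symm.trans hS⟩
    rintro k ⟨Q, hQ, hQf, rfl⟩
    exact hP.natDegree_le a hQ (hQf.trans hass.symm.dvd)
  · right
    refine ⟨(f.leadingCoeff, m), ⟨Set.mem_univ _, hm, hmn, hS⟩, ?_⟩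
    change C f.leadingCoeff * m = f
    rw [hmdef, mul_left_comm, ← C_mul, mul_inv_cancel₀ hl, C_1, mul_one]

theorem ncard_degree_eq_le {n : ℕ} (hn : 0 < n) :
    {f : F[X] | f.degree = n}.ncard ≤
      (typicalSet a n).ncard + Fintype.card F * (exceptionalSet a n).ncard := by
  have hT : (typicalSet a n).Finite := (finite_degree_eq F n).subset fun f hf => hf.1
  have hE : (Set.univ ×ˢ exceptionalSet a n : Set (F × F[X])).Finite :=
    Set.finite_univ.prod (finite_exceptionalSet a n)
  refine (Set.ncard_le_ncard (setOf_degree_eq_subset a hn) (hT.union (hE.image _))).trans ?_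
  refine (Set.ncard_union_le _ _).trans (Nat.add_le_add_left ?_ _)
  refine (Set.ncard_image_le hE).trans_eq ?_
  rw [Set.ncard_prod, Set.ncard_univ, Nat.card_eq_fintype_card]

theorem one_sub_le_ncard_typicalSet_div {n : ℕ} (hn : 3249 ≤ n) :
    1 - 4 * Fintype.card F * Real.exp (-(1 / 3 * Real.sqrt n)) ≤
      ((typicalSet a n).ncard : ℝ) / ({f : F[X] | f.degree = n}.ncard : ℕ) := by
  have hq : (0 : ℝ) < Fintype.card F := by exact_mod_cast Fintype.card_pos (α := F)
  have hD : (Fintype.card F : ℝ) ^ n ≤ ({f : F[X] | f.degree = n}.ncard : ℕ) := by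
    exact_mod_cast card_pow_le_ncard_degree_eq (F := F) n
  have h1 : (({f : F[X] | f.degree = n}.ncard : ℕ) : ℝ) ≤
      (typicalSet a n).ncard + Fintype.card F * (exceptionalSet a n).ncard := by
    exact_mod_cast ncard_degree_eq_le a (by omega : 0 < n)
  have h2 := ncard_exceptionalSet_lt a (n := n) (c := 1 / 3) (N := 57) le_rfl
    (by norm_num; exact_mod_cast hn) (by norm_num) (by norm_num)
  set D : ℝ := (({f : F[X] | f.degree = n}.ncard : ℕ) : ℝ)
  have hD0 : 0 < D := lt_of_lt_of_le (by positivity) hD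
  rw [le_div_iff₀ hD0]
  have h3 : (Fintype.card F : ℝ) * (exceptionalSet a n).ncard ≤
      4 * Fintype.card F * Real.exp (-(1 / 3 * Real.sqrt n)) * D := by
    calc _ ≤ (Fintype.card F : ℝ) * (4 * (Fintype.card F : ℝ) ^ n *
            Real.exp (-(1 / 3 * Real.sqrt n))) := by gcongr
      _ ≤ (Fintype.card F : ℝ) * (4 * D * Real.exp (-(1 / 3 * Real.sqrt n))) := by gcongr
      _ = _ := by ring
  linarith

theorem tendsto_ncard_typicalSet_div :
    Filter.Tendsto (fun n : ℕ => ((typicalSet a n).ncard : ℝ) /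
      (({f : F[X] | f.degree = n}.ncard : ℕ) : ℝ)) Filter.atTop (nhds 1) := by
  have h0 : Filter.Tendsto (fun n : ℕ => Real.exp (-(1 / 3 * Real.sqrt n)))
      Filter.atTop (nhds 0) := by
    refine Real.tendsto_exp_neg_atTop_nhds_zero.comp ?_
    refine Filter.Tendsto.const_mul_atTop (by norm_num) ?_
    exact Real.tendsto_sqrt_atTop.comp tendsto_natCast_atTop_atTop
  have h1 := (h0.const_mul (4 * (Fintype.card F : ℝ))).const_sub 1
  rw [mul_zero, sub_zero] at h1
  refine tendsto_of_tendsto_of_tendsto_of_le_of_le' h1 tendsto_const_nhds ?_ ?_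
  · filter_upwards [Filter.eventually_ge_atTop 3249] with n hn
    exact one_sub_le_ncard_typicalSet_div a hn
  · refine Filter.Eventually.of_forall fun n => div_le_one_of_le₀ ?_ (Nat.cast_nonneg _)
    have hsub : typicalSet a n ⊆ {f : F[X] | f.degree = n} := fun f hf => hf.1
    exact_mod_cast Set.ncard_le_ncard hsub (finite_degree_eq F n)

end Density

end CarlitzSmarandache

theorem theorem4p1 {F : Type*} [Field F] [Fintype F]
    (a : CarlitzSmarandache.Enumeration F) :
    (Fintype.card F = 2 → ∀ n : ℕ, 3249 ≤ n →
      ((CarlitzSmarandache.exceptionalSet a n).ncard : ℝ) <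
        2 ^ (n + 2) * Real.exp (-(Real.sqrt n / 3))) ∧
    (3 ≤ Fintype.card F → ∀ n : ℕ, max 13000 (Real.log (Fintype.card F)) ≤ (n : ℝ) →
      ((CarlitzSmarandache.exceptionalSet a n).ncard : ℝ) <
        4 * (Fintype.card F : ℝ) ^ n * Real.exp (-(Real.sqrt n / 2))) ∧
    Filter.Tendsto
      (fun n : ℕ =>
        (({f : F[X] | f.degree = n ∧
            ∃ d : ℕ, IsGreatest {k : ℕ | ∃ P : F[X], Irreducible P ∧ P ∣ f ∧ P.natDegree = k} d ∧
              CarlitzSmarandache.smarandache a f = X ^ d}.ncard : ℕ) : ℝ) /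
          (({f : F[X] | f.degree = n}.ncard : ℕ) : ℝ))
      Filter.atTop (nhds 1) := by
  refine ⟨fun hq n hn => ?_, fun _ n hn => ?_, CarlitzSmarandache.tendsto_ncard_typicalSet_div a⟩
  · have h := CarlitzSmarandache.ncard_exceptionalSet_lt a (n := n) (c := 1 / 3) (N := 57) le_rfl
      (by norm_num; exact_mod_cast hn) (by norm_num) (by norm_num)
    rw [hq] at h
    refine h.trans_eq ?_
    rw [one_div_mul_eq_div, pow_add]
    push_cast
    ring
  -- `114^2 = 12996 ≤ 13000`; for `c = 1/2` the value `N = 57` would just fail, as `0.402 * 57 <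
  -- 23.1`.
  · have h := CarlitzSmarandache.ncard_exceptionalSet_lt a (n := n) (c := 1 / 2) (N := 114)
      (by norm_num) (by linarith [(le_max_left _ _).trans hn]) (by norm_num) (by norm_num)
    rwa [one_div_mul_eq_div] at h
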